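/- Let $\mathcal X$ be a Polish space with its Borel $\sigma$-algebra, let $\gamma$ be a measure on $\mathcal X$, and let $I:\mathcal X\to[0,\infty]$ have compact sublevel sets $\{I\le M\}$, $M\in[0,\infty)$. Assume that for every $\varepsilon\in(0,\infty)$ $$\mu^{\varepsilon}(dx)=\frac1{Z^{\varepsilon}}e^{-I(x)/\varepsilon}\gamma(dx),\qquad Z^{\varepsilon}=\int_{\mathcal X} e^{-I(x)/\varepsilon}\,\gamma(dx),$$ is a well-defined probability measure (that is, $0<Z^\varepsilon<\infty$; here $e^{-\infty}=0$), and that $\{\mu^\varepsilon\}$ satisfies, as $\varepsilon\downarrow0$, the large deviation principle with scaling $\varepsilon$ and rate function $I$: $\limsup_{\varepsilon\to0}\varepsilon\log\mu^\varepsilon(C)\le-\inf_C I$ for every closed $C$ and $\liminf_{\varepsilon\to0}\varepsilon\log\mu^\varepsilon(U)\ge-\inf_U I$ for every open $U$. Assume that $I$ is continuous on $\{I<\infty\}$, and let $F:\mathcal X\to\mathbb R$ be continuous and bounded below. Let $K\ge1$ and let $\boldsymbol\alpha=(\alpha_1,\dots,\alpha_K)$ satisfy $1=\alpha_1\ge\alpha_2\ge\cdots\ge\alpha_K\ge0$.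 For each $\varepsilon>0$ let $X_1^\varepsilon,\dots,X_K^\varepsilon$ be independent with $X_j^\varepsilon\sim\mu^{\varepsilon/\alpha_j}$; if $\alpha_j=0$, then $\mu^{\varepsilon/\alpha_j}=\mu^{\infty}$ is the normalized reference measure $\gamma/\gamma(\mathcal X)$, and it is then understood that $\gamma(\mathcal X)<\infty$. Let $\Sigma_K$ be the set of permutations of $\{1,\dots,K\}$, write $\mathbf x_\sigma=(x_{\sigma(1)},\dots,x_{\sigma(K)})$, and define (with $0\cdot\infty=0$) the weights and the $K$-temperature INS estimator by $$\rho^\varepsilon(\mathbf x;\boldsymbol\alpha)=\frac{e^{-\frac1\varepsilon\sum_{j=1}^K\alpha_jI(x_j)}}{\sum_{\tau\in\Sigma_K}e^{-\frac1\varepsilon\sum_{j=1}^K\alpha_jI(x_{\tau(j)})}},\qquad \hat\eta^\varepsilon(\mathbf x;\boldsymbol\alpha)=\sum_{\sigma\in\Sigma_K}\rho^\varepsilon(\mathbf x_\sigma;\boldsymbol\alpha)\,e^{-\frac1\varepsilon F(x_{\sigma(1)})}.$$ Let $D=\{(I(x),F(x)):x\in\mathcal X\}$ and $$V_F(\boldsymbol\alpha)=\inf\Big[2\sum_{j=1}^K\alpha_jI_j+2f-\min_{\sigma\in\Sigma_K}\sum_{j=1}^K\alpha_jI_{\sigma(j)}\Big],$$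 the infimum being over all $(I_1,f)\in D$ with $I_1<\infty$ and all $I_2,\dots,I_K\in[0,I_1]$. Then $$\lim_{\varepsilon\to0}-\varepsilon\log E\Big[\big(\hat\eta^\varepsilon(\mathbf X^\varepsilon;\boldsymbol\alpha)\big)^2\Big]=V_F(\boldsymbol\alpha).$$ -/

import Mathlib

open MeasureTheory ProbabilityTheory Filter Topology
open scoped ENNReal NNReal

namespace INS

/-- `exp (-y)` for `y ∈ [0, ∞]`, with `exp (-∞) = 0`. -/
noncomputable def expNeg (y : ℝ≥0∞) : ℝ≥0∞ := EReal.exp (-(y : EReal))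

section Measures

variable {𝒳 : Type*} [MeasurableSpace 𝒳]

/-- The normalizing constant `Z^T = ∫ exp (-I / T) dγ` at temperature `T ∈ (0, ∞]`. -/
noncomputable def partitionFunction (γ : Measure 𝒳) (I : 𝒳 → ℝ≥0∞) (T : ℝ≥0∞) : ℝ≥0∞ :=
  ∫⁻ x, expNeg (I x / T) ∂γ

/-- The measure `μ^T (dx) = (1 / Z^T) exp (-I x / T) γ (dx)` at temperature `T ∈ (0, ∞]`.
At `T = ∞` it is the normalized reference measure `γ / γ(𝒳)`. It is a probability measure exactly
when `0 < Z^T < ∞`, and the zero measure otherwise. -/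
noncomputable def gibbsMeasure (γ : Measure 𝒳) (I : 𝒳 → ℝ≥0∞) (T : ℝ≥0∞) : Measure 𝒳 :=
  (partitionFunction γ I T)⁻¹ • γ.withDensity (fun x => expNeg (I x / T))

/-- The family `(μ ε)` for `ε > 0` satisfies the large deviation principle with scaling `ε` and
rate function `I`: `I` has compact sublevel sets, and the upper bound for closed sets and the
lower bound for open sets hold as `ε ↓ 0`. -/
structure SatisfiesLDP [TopologicalSpace 𝒳] (μ : ℝ → Measure 𝒳) (I : 𝒳 → ℝ≥0∞) : Prop where
  isCompact_sublevel : ∀ M : ℝ≥0, IsCompact {x | I x ≤ (M : ℝ≥0∞)}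
  upper_bound : ∀ C : Set 𝒳, IsClosed C →
    limsup (fun ε : ℝ => (ε : EReal) * ENNReal.log (μ ε C)) (𝓝[>] 0)
      ≤ -(⨅ x ∈ C, (I x : EReal))
  lower_bound : ∀ U : Set 𝒳, IsOpen U →
    -(⨅ x ∈ U, (I x : EReal))
      ≤ liminf (fun ε : ℝ => (ε : EReal) * ENNReal.log (μ ε U)) (𝓝[>] 0)

/-- The measures `μ^ε (dx) = (1 / Z^ε) exp (-I x / ε) γ (dx)`, `ε ∈ (0, ∞)`, are well-defined
probability measures and satisfy the large deviation principle with rate function `I`. -/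
structure GibbsLDP [TopologicalSpace 𝒳] (γ : Measure 𝒳) (I : 𝒳 → ℝ≥0∞) : Prop where
  isProbabilityMeasure : ∀ ε : ℝ, 0 < ε →
    IsProbabilityMeasure (gibbsMeasure γ I (ENNReal.ofReal ε))
  ldp : SatisfiesLDP (fun ε => gibbsMeasure γ I (ENNReal.ofReal ε)) I

end Measures

section Estimator

variable {𝒳 : Type*} {K : ℕ}

/-- `∑ j, α_j I (x_j)`, with the convention `0 * ∞ = 0`. -/
noncomputable def energy (I : 𝒳 → ℝ≥0∞) (α : Fin K → ℝ≥0) (x : Fin K → 𝒳) : ℝ≥0∞ :=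
  ∑ j, (α j : ℝ≥0∞) * I (x j)

/-- The weight `ρ^ε (x; α)`. -/
noncomputable def weight (I : 𝒳 → ℝ≥0∞) (α : Fin K → ℝ≥0) (ε : ℝ) (x : Fin K → 𝒳) : ℝ≥0∞ :=
  expNeg (energy I α x / ENNReal.ofReal ε) /
    ∑ τ : Equiv.Perm (Fin K), expNeg (energy I α (fun j => x (τ j)) / ENNReal.ofReal ε)

/-- The single-sample INS estimator
`η^ε (x; α) = ∑ σ, ρ^ε (x_σ; α) exp (-F (x_σ(1)) / ε)`. The index `0 : Fin K` is the first one. -/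
noncomputable def estimator [NeZero K] (I : 𝒳 → ℝ≥0∞) (F : 𝒳 → ℝ) (α : Fin K → ℝ≥0) (ε : ℝ)
    (x : Fin K → 𝒳) : ℝ≥0∞ :=
  ∑ σ : Equiv.Perm (Fin K),
    weight I α ε (fun j => x (σ j)) * ENNReal.ofReal (Real.exp (-F (x (σ 0)) / ε))

/-- The set `D` of all pairs `(I x, F x)`. -/
def valuePairs (I : 𝒳 → ℝ≥0∞) (F : 𝒳 → ℝ) : Set (ℝ≥0∞ × ℝ) :=
  Set.range fun x => (I x, F x)

/-- The expression minimized in the definition of the decay rate: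
`2 ∑ j, α_j J_j + 2 f - min_σ ∑ j, α_j J_σ(j)`. -/
noncomputable def objective (α J : Fin K → ℝ≥0) (f : ℝ) : ℝ :=
  2 * ∑ j, (α j : ℝ) * (J j : ℝ) + 2 * f
    - Finset.univ.inf' Finset.univ_nonempty
        (fun σ : Equiv.Perm (Fin K) => ∑ j, (α j : ℝ) * (J (σ j) : ℝ))

/-- The decay rate `V_F (α)`: the infimum of `objective α J f` over all `(J_1, f) ∈ D` with `J_1`
finite and all `J_j ∈ [0, J_1]`, `j ≥ 2`. -/
noncomputable def decayRate [NeZero K] (I : 𝒳 → ℝ≥0∞) (F : 𝒳 → ℝ) (α : Fin K → ℝ≥0) : EReal :=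
  ⨅ (J : Fin K → ℝ≥0) (f : ℝ) (_ : ((J 0 : ℝ≥0∞), f) ∈ valuePairs I F) (_ : ∀ j, J j ≤ J 0),
    (objective α J f : EReal)

end Estimator

end INS

namespace INS

/-! ### Rearrangement inequalities and reduction of the infimum to vertices. -/

section Rearrangement

variable {K : ℕ}

/-! For a sample x, let y = x_σ, let E be the energy of y and M the least energy over all
reorderings. Since α decreases, M is attained by sorting I(y_j) increasingly. The weight of σ is
e^{-(E-M)/ε} up to a factor K!, so the squared term is about e^{-(2E-2M+2F(y_1))/ε}.

Upper bound on the second moment: V_F ≤ 2E - M + 2F(y_1), so the squared term is at most e^{-V_F/ε}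
e^{M/ε}, and M is at most the energy of x, whose exponential is cancelled by the Gibbs densities. As
γ may be infinite, only a fraction 1-θ is cancelled; the rest leaves partition functions at
temperature ε/(θα_j), finite and bounded for ε ≤ 1 (`weight_mul_sq_le`, `lintegral_inv_expNeg_le`).
Energies above I(y_1) are not admissible in V_F; clipping them there only lowers 2E - M
(`sum_mul_sort_add_sum_mul_clip_le`).

Lower bound: the values of I need not fill [0, I_1], but for a fixed order the objective is linear,
so each J_j may be taken in {0, I_1} (`exists_objective_indicator_le`). Such values are nearly
attained on sets of positive γ-measure. Placing the sample there in increasing order of energy costs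
probability e^{-M/ε}, and one term of the estimator already gives e^{-(2E-2M+2f)/ε}; the product has
exponent 2E - M + 2f.

The large deviation principle enters only through inf I = 0 and the positivity of γ near points of
finite I; explicit exponential bounds do the rest. -/

lemma sum_mul_comp_perm_le_real {α : Fin K → ℝ≥0} (hα : Antitone α) {f : Fin K → ℝ}
    {σ : Equiv.Perm (Fin K)} (hf : Monotone (f ∘ σ)) (τ : Equiv.Perm (Fin K)) :
    ∑ j, (α j : ℝ) * f (σ j) ≤ ∑ j, (α j : ℝ) * f (τ j) := by
  have h : Antivary (fun j => (α j : ℝ)) (f ∘ σ) := by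
    intro i j hij
    have : i ≤ j := by
      by_contra hc
      exact absurd (hf (not_le.1 hc).le) (not_le.2 hij)
    exact_mod_cast hα this
  simpa using h.sum_mul_le_sum_mul_comp_perm (σ := τ.trans σ.symm)

/-- Infinite energies are reached by truncating at n, which preserves the order, and letting n tend
to infinity. -/
lemma sum_mul_comp_perm_le {α : Fin K → ℝ≥0} (hα : Antitone α) {f : Fin K → ℝ≥0∞}
    {σ : Equiv.Perm (Fin K)} (hf : Monotone (f ∘ σ)) (τ : Equiv.Perm (Fin K)) :
    ∑ j, (α j : ℝ≥0∞) * f (σ j) ≤ ∑ j, (α j : ℝ≥0∞) * f (τ j) := by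
  have hlim : ∀ π : Equiv.Perm (Fin K),
      Tendsto (fun n : ℕ => ∑ j, (α j : ℝ≥0∞) * min (f (π j)) n) atTop
        (𝓝 (∑ j, (α j : ℝ≥0∞) * f (π j))) := by
    intro π
    refine tendsto_finsetSum _ fun j _ => ENNReal.Tendsto.const_mul ?_ (Or.inr ENNReal.coe_ne_top)
    simpa using (tendsto_const_nhds (x := f (π j))).min ENNReal.tendsto_nat_nhds_top
  refine le_of_tendsto_of_tendsto' (hlim σ) (hlim τ) fun n => ?_
  have hfin : ∀ j, min (f j) n ≠ ∞ := fun j => ne_top_of_le_ne_top (by simp) (min_le_right _ _)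
  have hmono : Monotone ((fun j => (min (f j) (n : ℝ≥0∞)).toReal) ∘ σ) := fun i j hij =>
    ENNReal.toReal_mono (hfin _) (min_le_min_right _ (hf hij))
  have h := sum_mul_comp_perm_le_real hα hmono τ
  have key : ∀ π : Equiv.Perm (Fin K), ∑ j, (α j : ℝ≥0∞) * min (f (π j)) n
      = ENNReal.ofReal (∑ j, (α j : ℝ) * (min (f (π j)) (n : ℝ≥0∞)).toReal) := by
    intro π
    rw [ENNReal.ofReal_sum_of_nonneg fun j _ => by positivity]
    refine Finset.sum_congr rfl fun j _ => ?_
    rw [ENNReal.ofReal_mul (by positivity), ENNReal.ofReal_toReal (hfin _),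
      ENNReal.ofReal_coe_nnreal]
  rw [key, key]
  exact ENNReal.ofReal_le_ofReal h

/-- Split a = min(a, c) + (a - c)⁺. The excess is sorted by the same σ, so rearrangement applied to
the excess alone suffices: clipping cannot increase the energy gained by sorting. Sums replace
differences because terms may be infinite. -/
lemma sum_mul_sort_add_sum_mul_clip_le {α : Fin K → ℝ≥0} (hα : Antitone α) {f : Fin K → ℝ≥0∞}
    {σ : Equiv.Perm (Fin K)} (hf : Monotone (f ∘ σ)) (c : ℝ≥0∞) :
    ∑ j, (α j : ℝ≥0∞) * f (σ j) + ∑ j, (α j : ℝ≥0∞) * min (f j) c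
      ≤ ∑ j, (α j : ℝ≥0∞) * f j + ∑ j, (α j : ℝ≥0∞) * min (f (σ j)) c := by
  have hsplit : ∀ a : ℝ≥0∞, a = min a c + (a - c) := by
    intro a
    rcases le_total a c with h | h
    · simp [h, tsub_eq_zero_of_le h]
    · simp [min_eq_right h, add_tsub_cancel_of_le h]
  have hdecomp : ∀ π : Equiv.Perm (Fin K), ∑ j, (α j : ℝ≥0∞) * f (π j)
      = ∑ j, (α j : ℝ≥0∞) * min (f (π j)) c + ∑ j, (α j : ℝ≥0∞) * (f (π j) - c) := by
    intro π
    rw [← Finset.sum_add_distrib]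
    refine Finset.sum_congr rfl fun j _ => ?_
    rw [← mul_add, ← hsplit]
  have hmono : Monotone ((fun j => f j - c) ∘ σ) := fun i j hij =>
    tsub_le_tsub_right (hf hij) c
  have h := sum_mul_comp_perm_le hα hmono 1
  have h1 := hdecomp 1
  simp only [Equiv.Perm.coe_one, id_eq] at h h1
  rw [hdecomp σ, h1]
  calc _ = (∑ j, (α j : ℝ≥0∞) * min (f (σ j)) c + ∑ j, (α j : ℝ≥0∞) * min (f j) c)
        + ∑ j, (α j : ℝ≥0∞) * (f (σ j) - c) := by ring
    _ ≤ (∑ j, (α j : ℝ≥0∞) * min (f (σ j)) c + ∑ j, (α j : ℝ≥0∞) * min (f j) c)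
        + ∑ j, (α j : ℝ≥0∞) * (f j - c) := by gcongr
    _ = _ := by ring

lemma objective_eq_of_monotone {α : Fin K → ℝ≥0} (hα : Antitone α) {J : Fin K → ℝ≥0}
    {σ : Equiv.Perm (Fin K)} (hJ : Monotone (J ∘ σ)) (f : ℝ) :
    objective α J f = 2 * ∑ j, (α j : ℝ) * (J j : ℝ) + 2 * f
      - ∑ j, (α j : ℝ) * (J (σ j) : ℝ) := by
  unfold objective
  congr 1
  refine le_antisymm (Finset.inf'_le _ (Finset.mem_univ σ)) (Finset.le_inf' _ _ fun τ _ => ?_)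
  exact sum_mul_comp_perm_le_real hα (f := fun j => (J j : ℝ))
    (fun i j hij => by exact_mod_cast hJ hij) τ

/-- Layer cake: J_j is the average over t in [0, J_0) of J_0 times the indicator of t < J_j. Some t
does no worse than the average. -/
lemma exists_threshold_le [NeZero K] (c : Fin K → ℝ) (J : Fin K → ℝ≥0) (hJ : ∀ j, J j ≤ J 0)
    (h0 : 0 < J 0) :
    ∃ t : ℝ, t < J 0 ∧ ∑ j, c j * (if t < J j then (J 0 : ℝ) else 0) ≤ ∑ j, c j * J j := by
  have hpos : (0 : ℝ) < J 0 := by exact_mod_cast h0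
  have hint : ∀ j, IntegrableOn (fun t : ℝ => c j * (if t < J j then (J 0 : ℝ) else 0))
      (Set.Ico 0 (J 0 : ℝ)) := by
    intro j
    refine Integrable.const_mul ?_ _
    refine Integrable.mono' (g := fun _ => (J 0 : ℝ)) (by simp)
      (Measurable.ite measurableSet_Iio measurable_const measurable_const).aestronglyMeasurable ?_
    refine Eventually.of_forall fun t => ?_
    split_ifs <;> simp
  have hvol : (volume (Set.Ico 0 (J 0 : ℝ))) ≠ 0 := by simp [h0.ne']
  obtain ⟨t, ht, hle⟩ := exists_le_setAverage hvol (by simp)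
    (integrable_finsetSum Finset.univ fun j _ => hint j)
  refine ⟨t, ht.2, ?_⟩
  refine hle.trans (le_of_eq ?_)
  rw [setAverage_eq, integral_finsetSum _ fun j _ => hint j]
  rw [smul_eq_mul, Finset.mul_sum]
  refine Finset.sum_congr rfl fun j _ => ?_
  rw [integral_const_mul]
  have : (fun t : ℝ => if t < J j then (J 0 : ℝ) else 0)
      = (Set.Iio (J j : ℝ)).indicator fun _ => (J 0 : ℝ) := by
    ext t; simp [Set.indicator_apply]
  have hJj : (J j : ℝ) ≤ J 0 := by exact_mod_cast hJ j
  rw [this, setIntegral_indicator measurableSet_Iio, Set.Ico_inter_Iio, min_eq_right hJj]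
  simp [Measure.real]
  field_simp

/-- The infimum over the order simplex is approached at its vertices. -/
lemma exists_objective_indicator_le [NeZero K] {α : Fin K → ℝ≥0} (hα : Antitone α)
    {J : Fin K → ℝ≥0} (hJ : ∀ j, J j ≤ J 0) (f : ℝ) :
    ∃ J' : Fin K → ℝ≥0, J' 0 = J 0 ∧ (∀ j, J' j = 0 ∨ J' j = J 0) ∧
      objective α J' f ≤ objective α J f := by
  rcases eq_or_ne (J 0) 0 with h0 | h0
  · refine ⟨J, rfl, fun j => Or.inl ?_, le_rfl⟩
    simpa [h0] using hJ j
  set σ := Tuple.sort J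
  have hσ : Monotone (J ∘ σ) := Tuple.monotone_sort J
  -- On the vectors sorted by σ the objective is linear, with these coefficients up to the constant
  -- 2f. Thresholding preserves the order, so the same linear form applies afterwards.
  obtain ⟨t, ht, hle⟩ := exists_threshold_le (fun j => 2 * (α j : ℝ) - α (σ.symm j)) J hJ
    (pos_iff_ne_zero.2 h0)
  have hsum : ∀ g : Fin K → ℝ, ∑ j, (2 * (α j : ℝ) - α (σ.symm j)) * g j
      = 2 * ∑ j, (α j : ℝ) * g j - ∑ j, (α j : ℝ) * g (σ j) := by
    intro g
    rw [← Equiv.sum_comp σ.symm (fun j => (α j : ℝ) * g (σ j)), Finset.mul_sum,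
      ← Finset.sum_sub_distrib]
    refine Finset.sum_congr rfl fun j _ => ?_
    rw [Equiv.apply_symm_apply]; ring
  refine ⟨fun j => if t < J j then J 0 else 0, by simp [ht], fun j => ?_, ?_⟩
  · by_cases h : t < J j <;> simp [h]
  have hmono : Monotone ((fun j => if t < (J j : ℝ) then J 0 else 0) ∘ σ) := by
    intro i j hij
    have h1 : (J (σ i) : ℝ) ≤ J (σ j) := by exact_mod_cast hσ hij
    simp only [Function.comp_apply]
    split_ifs with h2 h3
    · exact le_rfl
    · exact absurd (h2.trans_le h1) h3
    · exact zero_le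
    · exact le_rfl
  rw [objective_eq_of_monotone hα hmono, objective_eq_of_monotone hα hσ]
  rw [hsum, hsum (fun j => (J j : ℝ))] at hle
  have hc : ∀ j, ((if t < (J j : ℝ) then J 0 else 0 : ℝ≥0) : ℝ)
      = if t < (J j : ℝ) then (J 0 : ℝ) else 0 := by
    intro j; split_ifs <;> simp
  simp only [hc]
  linarith

end Rearrangement

/-! ### The extended exponential. -/

section ExpNeg

lemma expNeg_coe (t : ℝ≥0) : expNeg t = ENNReal.ofReal (Real.exp (-(t : ℝ))) := by
  unfold expNeg
  rw [← EReal.exp_coe, EReal.coe_neg]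
  rfl

lemma expNeg_top : expNeg ∞ = 0 := by simp [expNeg]

lemma expNeg_zero : expNeg 0 = 1 := by simp [expNeg]

lemma expNeg_antitone : Antitone expNeg := fun _ _ hab =>
  EReal.exp_monotone (EReal.neg_le_neg_iff.2 (EReal.coe_ennreal_le_coe_ennreal_iff.2 hab))

lemma measurable_expNeg : Measurable expNeg := expNeg_antitone.measurable

lemma expNeg_add (a b : ℝ≥0∞) : expNeg (a + b) = expNeg a * expNeg b := by
  induction a using ENNReal.recTopCoe with
  | top => simp [expNeg_top]
  | coe a =>
    induction b using ENNReal.recTopCoe with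
    | top => simp [expNeg_top]
    | coe b =>
      rw [← ENNReal.coe_add, expNeg_coe, expNeg_coe, expNeg_coe,
        ← ENNReal.ofReal_mul (by positivity), ← Real.exp_add]
      congr 2
      push_cast
      ring

lemma expNeg_sum {ι : Type*} (s : Finset ι) (f : ι → ℝ≥0∞) :
    expNeg (∑ i ∈ s, f i) = ∏ i ∈ s, expNeg (f i) := by
  classical
  induction s using Finset.induction_on with
  | empty => simp [expNeg_zero]
  | insert a s ha ih => rw [Finset.sum_insert ha, Finset.prod_insert ha, expNeg_add, ih]

lemma expNeg_ne_top (a : ℝ≥0∞) : expNeg a ≠ ∞ := by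
  refine ne_top_of_le_ne_top ENNReal.one_ne_top ?_
  rw [← expNeg_zero]
  exact expNeg_antitone zero_le

lemma expNeg_coe_div {ε : ℝ} (hε : 0 < ε) (t : ℝ≥0) :
    expNeg (t / ENNReal.ofReal ε) = ENNReal.ofReal (Real.exp (-(t : ℝ) / ε)) := by
  lift ε to ℝ≥0 using hε.le
  have : ε ≠ 0 := by
    rintro rfl
    simp at hε
  rw [ENNReal.ofReal_coe_nnreal, ← ENNReal.coe_div this, expNeg_coe]
  push_cast
  rw [neg_div]

end ExpNeg

/-! ### Gibbs measures and partition functions. -/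

section Gibbs

variable {𝒳 : Type*} [MeasurableSpace 𝒳] {γ : Measure 𝒳} {I : 𝒳 → ℝ≥0∞}

lemma div_ofReal_div {ε : ℝ} (hε : 0 < ε) (a : ℝ≥0) (y : ℝ≥0∞) :
    y / (ENNReal.ofReal ε / a) = a * y / ENNReal.ofReal ε := by
  have h0 : ENNReal.ofReal ε ≠ 0 := by simpa using hε
  rw [div_eq_mul_inv, ENNReal.inv_div (Or.inl ENNReal.coe_ne_top) (Or.inr h0),
    div_eq_mul_inv, div_eq_mul_inv]
  ring

lemma partitionFunction_ofReal_div {ε : ℝ} (hε : 0 < ε) (a : ℝ≥0) :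
    partitionFunction γ I (ENNReal.ofReal ε / a)
      = ∫⁻ x, expNeg (a * I x / ENNReal.ofReal ε) ∂γ := by
  simp only [partitionFunction, div_ofReal_div hε]

lemma partitionFunction_mono {S T : ℝ≥0∞} (h : S ≤ T) :
    partitionFunction γ I S ≤ partitionFunction γ I T :=
  lintegral_mono fun _ => expNeg_antitone (ENNReal.div_le_div_left h _)

lemma gibbsMeasure_univ (T : ℝ≥0∞) : gibbsMeasure γ I T Set.univ
    = (partitionFunction γ I T)⁻¹ * partitionFunction γ I T := by
  simp [gibbsMeasure, partitionFunction]

lemma partitionFunction_ne_top {T : ℝ≥0∞} (h : IsProbabilityMeasure (gibbsMeasure γ I T)) :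
    partitionFunction γ I T ≠ ∞ := by
  intro h0
  have := h.measure_univ
  rw [gibbsMeasure_univ, h0] at this
  simp at this

lemma lintegral_gibbsMeasure (hI : Measurable I) (T : ℝ≥0∞) {g : 𝒳 → ℝ≥0∞} (hg : Measurable g) :
    ∫⁻ x, g x ∂(gibbsMeasure γ I T)
      = (partitionFunction γ I T)⁻¹ * ∫⁻ x, expNeg (I x / T) * g x ∂γ := by
  have hm : Measurable fun x => expNeg (I x / T) := measurable_expNeg.comp (hI.div_const T)
  rw [gibbsMeasure, lintegral_smul_measure, lintegral_withDensity_eq_lintegral_mul _ hm hg]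
  rfl

lemma le_gibbsMeasure {ε : ℝ} (hε : 0 < ε) (a b : ℝ≥0) {A : Set 𝒳} (hA : MeasurableSet A)
    (hb : ∀ x ∈ A, I x ≤ b) :
    (partitionFunction γ I (ENNReal.ofReal ε / a))⁻¹ *
        (ENNReal.ofReal (Real.exp (-(a * b : ℝ) / ε)) * γ A)
      ≤ gibbsMeasure γ I (ENNReal.ofReal ε / a) A := by
  rw [gibbsMeasure, Measure.smul_apply, withDensity_apply _ hA, smul_eq_mul]
  gcongr
  rw [← setLIntegral_const]
  refine setLIntegral_mono' hA fun x hx => ?_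
  rw [div_ofReal_div hε]
  have := expNeg_coe_div hε (a * b)
  push_cast at this
  rw [← this]
  refine expNeg_antitone (ENNReal.div_le_div_right ?_ _)
  gcongr
  exact hb x hx

lemma le_partitionFunction {ε : ℝ} (hε : 0 < ε) {a : ℝ≥0} (ha : a ≤ 1) (d : ℝ≥0) {A : Set 𝒳}
    (hA : MeasurableSet A) (hd : ∀ x ∈ A, I x ≤ d) :
    ENNReal.ofReal (Real.exp (-(d : ℝ) / ε)) * γ A
      ≤ partitionFunction γ I (ENNReal.ofReal ε / a) := by
  rw [partitionFunction_ofReal_div hε, ← setLIntegral_const]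
  refine (setLIntegral_mono' hA fun x hx => ?_).trans (setLIntegral_le_lintegral _ _)
  rw [← expNeg_coe_div hε]
  refine expNeg_antitone (ENNReal.div_le_div_right ?_ _)
  calc (a : ℝ≥0∞) * I x ≤ 1 * I x := by gcongr; exact_mod_cast ha
    _ ≤ d := by rw [one_mul]; exact hd x hx

/-- The integrand cancels a fraction 1 - θ of the Gibbs exponent; the remaining fraction θ is a
Gibbs weight at temperature raised by 1/θ. It is an inequality because 0 · ∞ = 0 where the weight
vanishes. -/
lemma lintegral_inv_expNeg_le (hI : Measurable I) {ε θ : ℝ} (hε : 0 < ε) (hθ : 0 < θ)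
    (hθ1 : θ < 1) (a : ℝ≥0) :
    ∫⁻ x, (expNeg (ENNReal.ofReal (1 - θ) * (a * I x / ENNReal.ofReal ε)))⁻¹
        ∂(gibbsMeasure γ I (ENNReal.ofReal ε / a))
      ≤ (partitionFunction γ I (ENNReal.ofReal ε / a))⁻¹ *
        partitionFunction γ I (ENNReal.ofReal (ε / θ) / a) := by
  rw [lintegral_gibbsMeasure hI, partitionFunction_ofReal_div (div_pos hε hθ)]
  · gcongr with x
    rw [div_ofReal_div hε]
    set u := (a : ℝ≥0∞) * I x / ENNReal.ofReal ε with hu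
    have h1 : u = ENNReal.ofReal (1 - θ) * u + ENNReal.ofReal θ * u := by
      rw [← add_mul, ← ENNReal.ofReal_add (by linarith) hθ.le]
      simp
    have h2 : (a : ℝ≥0∞) * I x / ENNReal.ofReal (ε / θ) = ENNReal.ofReal θ * u := by
      rw [hu, ENNReal.ofReal_div_of_pos hθ, div_eq_mul_inv, ENNReal.inv_div (by simp)
        (Or.inl (by simpa using hθ)), div_eq_mul_inv, div_eq_mul_inv]
      ring
    rw [h2]
    nth_rw 1 [h1]
    rw [expNeg_add, mul_right_comm]
    exact mul_le_of_le_one_left' (ENNReal.mul_inv_le_one _)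
  · exact (measurable_expNeg.comp ((((hI.const_mul _).div_const _)).const_mul _)).inv

end Gibbs

/-! ### Consequences of the large deviation principle for I and γ. -/

section LargeDeviations

variable {𝒳 : Type*} [TopologicalSpace 𝒳] [MeasurableSpace 𝒳]
  {γ : Measure 𝒳} {I : 𝒳 → ℝ≥0∞}

/-- The upper bound on the whole space, which has mass one, reads 0 ≤ -inf I. -/
lemma GibbsLDP.exists_lt (h : GibbsLDP γ I) {d : ℝ≥0} (hd : 0 < d) : ∃ x, I x < d := by
  by_contra! hc
  have h1 := h.ldp.upper_bound Set.univ isClosed_univ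
  have h2 : (fun ε : ℝ => (ε : EReal) *
      ENNReal.log (gibbsMeasure γ I (ENNReal.ofReal ε) Set.univ)) =ᶠ[𝓝[>] 0] fun _ => 0 := by
    filter_upwards [self_mem_nhdsWithin] with ε hε
    have := (h.isProbabilityMeasure ε hε).measure_univ
    simp [this]
  rw [limsup_congr h2, limsup_const] at h1
  have h3 : ((d : ℝ≥0∞) : EReal) ≤ ⨅ x ∈ (Set.univ : Set 𝒳), (I x : EReal) :=
    le_iInf₂ fun x _ => EReal.coe_ennreal_le_coe_ennreal_iff.2 (hc x)
  have h4 : (⨅ x ∈ (Set.univ : Set 𝒳), (I x : EReal)) ≤ 0 := by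
    simpa using EReal.neg_le_neg_iff.2 h1
  have h5 := h3.trans h4
  norm_cast at h5
  exact absurd h5 (by simpa using hd.ne')

variable [BorelSpace 𝒳]

lemma SatisfiesLDP.measurable [T2Space 𝒳] {μ : ℝ → Measure 𝒳} (h : SatisfiesLDP μ I) :
    Measurable I := by
  refine measurable_of_Iic fun M => ?_
  induction M using ENNReal.recTopCoe with
  | top => simp
  | coe M => exact (h.isCompact_sublevel M).isClosed.measurableSet

/-- Otherwise every Gibbs measure would give U mass zero, and the lower bound would force I = ∞ on
U. -/
lemma GibbsLDP.measure_inter_pos (h : GibbsLDP γ I) {U : Set 𝒳} (hU : IsOpen U) {x : 𝒳}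
    (hx : x ∈ U) (hIx : I x < ∞) : γ (U ∩ {y | I y < ∞}) ≠ 0 := by
  intro h0
  have h1 := h.ldp.lower_bound U hU
  have h2 : (fun ε : ℝ => (ε : EReal) *
      ENNReal.log (gibbsMeasure γ I (ENNReal.ofReal ε) U)) =ᶠ[𝓝[>] 0] fun _ => ⊥ := by
    filter_upwards [self_mem_nhdsWithin] with ε hε
    have hz : gibbsMeasure γ I (ENNReal.ofReal ε) U = 0 := by
      rw [gibbsMeasure, Measure.smul_apply, withDensity_apply _ hU.measurableSet, smul_eq_mul]
      refine mul_eq_zero_of_right _ ?_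
      rw [← lintegral_zero (μ := γ.restrict U)]
      refine lintegral_congr_ae ?_
      rw [EventuallyEq, ae_restrict_iff' hU.measurableSet, ae_iff]
      refine measure_mono_null (fun y hy => ?_) h0
      simp only [Set.mem_ofPred_eq, Classical.not_imp] at hy
      refine ⟨hy.1, show I y < ∞ from lt_top_iff_ne_top.2 fun hc => hy.2 ?_⟩
      rw [hc, ENNReal.top_div_of_ne_top ENNReal.ofReal_ne_top, expNeg_top]
    rw [hz, ENNReal.log_zero, EReal.coe_mul_bot_of_pos hε]
  rw [liminf_congr h2, liminf_const, le_bot_iff, EReal.neg_eq_bot_iff] at h1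
  have h3 : (⨅ y ∈ U, (I y : EReal)) ≤ I x := iInf₂_le x hx
  rw [h1, top_le_iff] at h3
  exact hIx.ne (EReal.coe_ennreal_eq_top_iff.1 h3)

lemma GibbsLDP.measure_near_ne_zero (h : GibbsLDP γ I) (hI : ContinuousOn I {x | I x < ∞})
    {F : 𝒳 → ℝ} (hF : Continuous F) {x : 𝒳} (hIx : I x < ∞) {δ : ℝ≥0} (hδ : 0 < δ) :
    γ {y | I x ≤ I y + δ ∧ I y ≤ I x + δ ∧ F y ≤ F x + δ} ≠ 0 := by
  have hδ' : (0 : ℝ≥0∞) < δ := by exact_mod_cast hδ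
  have hc : ContinuousWithinAt I {x | I x < ∞} x := hI x hIx
  have h1 : {y | I y < I x + δ} ∈ 𝓝[{x | I x < ∞}] x :=
    hc.eventually_lt_const (ENNReal.lt_add_right hIx.ne hδ'.ne')
  have h2 : {y | I x < I y + δ} ∈ 𝓝[{x | I x < ∞}] x :=
    (hc.add continuousWithinAt_const).eventually_const_lt (ENNReal.lt_add_right hIx.ne hδ'.ne')
  have h3 : {y | F y < F x + δ} ∈ 𝓝 x :=
    hF.continuousAt.eventually_lt_const (by simpa using hδ)
  obtain ⟨U, hU, hxU, hsub⟩ := mem_nhdsWithin.1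
    (Filter.inter_mem (Filter.inter_mem h1 h2) (mem_nhdsWithin_of_mem_nhds h3))
  refine fun h0 => h.measure_inter_pos hU hxU hIx (measure_mono_null (fun y hy => ?_) h0)
  obtain ⟨⟨a, b⟩, c⟩ := hsub hy
  exact ⟨le_of_lt b, le_of_lt a, le_of_lt c⟩

end LargeDeviations

/-! ### Constants are negligible on the exponential scale. -/

section Asymptotics

lemma eventually_le_exp_div {C : ℝ≥0∞} (hC : C ≠ ∞) {d : ℝ} (hd : 0 < d) :
    ∀ᶠ ε : ℝ in 𝓝[>] 0, C ≤ ENNReal.ofReal (Real.exp (d / ε)) := by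
  have h1 : Tendsto (fun ε : ℝ => Real.exp (d / ε)) (𝓝[>] 0) atTop := by
    have h2 : Tendsto (fun ε : ℝ => d / ε) (𝓝[>] 0) atTop := by
      simpa only [div_eq_mul_inv] using tendsto_inv_nhdsGT_zero.const_mul_atTop hd
    exact Real.tendsto_exp_atTop.comp h2
  filter_upwards [h1.eventually_ge_atTop C.toReal] with ε hε
  rw [← ENNReal.ofReal_toReal hC]
  exact ENNReal.ofReal_le_ofReal hε

lemma eventually_exp_neg_div_le {C : ℝ≥0∞} (hC : C ≠ 0) {d : ℝ} (hd : 0 < d) :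
    ∀ᶠ ε : ℝ in 𝓝[>] 0, ENNReal.ofReal (Real.exp (-d / ε)) ≤ C := by
  filter_upwards [eventually_le_exp_div (ENNReal.inv_ne_top.2 hC) hd] with ε hε
  rw [neg_div, Real.exp_neg, ENNReal.ofReal_inv_of_pos (Real.exp_pos _)]
  exact ENNReal.inv_le_iff_inv_le.1 hε

lemma ofReal_exp_mul (a b : ℝ) : ENNReal.ofReal (Real.exp a) * ENNReal.ofReal (Real.exp b)
    = ENNReal.ofReal (Real.exp (a + b)) := by
  rw [← ENNReal.ofReal_mul (Real.exp_nonneg _), Real.exp_add]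

lemma ofReal_exp_pow (a : ℝ) (n : ℕ) :
    ENNReal.ofReal (Real.exp a) ^ n = ENNReal.ofReal (Real.exp (n * a)) := by
  rw [← ENNReal.ofReal_pow (Real.exp_nonneg _), Real.exp_nat_mul]

end Asymptotics

/-! ### Upper bound on the second moment. -/

section UpperBound

variable {𝒳 : Type*} {K : ℕ} [NeZero K] {I : 𝒳 → ℝ≥0∞} {F : 𝒳 → ℝ} {α : Fin K → ℝ≥0}

/-- Sorting a configuration of finite energy minimizes its energy, and the minimum obeys the
inequality that defines the decay rate, although the energies are not bounded by the first one. -/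
lemma exists_perm_decayRate_le (hα1 : α 0 = 1) (hα : Antitone α) {v : ℝ}
    (hv : (v : EReal) ≤ decayRate I F α) {y : Fin K → 𝒳} (hy : energy I α y ≠ ∞) :
    ∃ τ : Equiv.Perm (Fin K),
      (∀ π : Equiv.Perm (Fin K), energy I α (fun j => y (τ j)) ≤ energy I α (fun j => y (π j))) ∧
      v ≤ 2 * (energy I α y).toReal - (energy I α (fun j => y (τ j))).toReal + 2 * F (y 0) := by
  set f : Fin K → ℝ≥0∞ := fun j => I (y j) with hf
  set τ := Tuple.sort f
  have hτ : Monotone (f ∘ τ) := Tuple.monotone_sort f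
  have hmin : ∀ π : Equiv.Perm (Fin K),
      energy I α (fun j => y (τ j)) ≤ energy I α (fun j => y (π j)) :=
    sum_mul_comp_perm_le hα hτ
  refine ⟨τ, hmin, ?_⟩
  have h0 : f 0 ≠ ∞ := by
    refine ne_top_of_le_ne_top hy ?_
    calc f 0 = (α 0 : ℝ≥0∞) * I (y 0) := by simp [hα1, hf]
      _ ≤ energy I α y := Finset.single_le_sum (f := fun j => (α j : ℝ≥0∞) * I (y j))
          (fun _ _ => zero_le) (Finset.mem_univ 0)
  -- Clipping at the first energy makes J admissible for the infimum; `hclip` and `hle` below pay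
  -- for the clipping.
  set J : Fin K → ℝ≥0 := fun j => (min (f j) (f 0)).toNNReal with hJ
  have hJc : ∀ j, (J j : ℝ≥0∞) = min (f j) (f 0) := fun j =>
    ENNReal.coe_toNNReal (ne_top_of_le_ne_top h0 (min_le_right _ _))
  have hJ0 : ∀ j, J j ≤ J 0 := by
    intro j
    rw [← ENNReal.coe_le_coe, hJc, hJc]
    simp
  have hobj : v ≤ objective α J (F (y 0)) := by
    have : decayRate I F α ≤ (objective α J (F (y 0)) : EReal) := by
      refine iInf_le_of_le J (iInf_le_of_le (F (y 0)) (iInf_le_of_le ⟨y 0, ?_⟩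
        (iInf_le_of_le hJ0 le_rfl)))
      simp [hJc, hf]
    exact_mod_cast hv.trans this
  have hJmono : Monotone (J ∘ τ) := by
    intro i j hij
    simp only [Function.comp_apply]
    rw [← ENNReal.coe_le_coe, hJc, hJc]
    exact min_le_min_right _ (hτ hij)
  rw [objective_eq_of_monotone hα hJmono] at hobj
  have hclip := sum_mul_sort_add_sum_mul_clip_le hα hτ (f 0)
  have hsum : ∀ π : Equiv.Perm (Fin K), ∑ j, (α j : ℝ≥0∞) * min (f (π j)) (f 0)
      = ENNReal.ofReal (∑ j, (α j : ℝ) * J (π j)) := by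
    intro π
    rw [ENNReal.ofReal_sum_of_nonneg fun j _ => by positivity]
    refine Finset.sum_congr rfl fun j _ => ?_
    rw [← hJc, ENNReal.ofReal_mul (by positivity), ENNReal.ofReal_coe_nnreal,
      ENNReal.ofReal_coe_nnreal]
  have hsum1 := hsum 1
  simp only [Equiv.Perm.coe_one, id_eq] at hsum1
  rw [hsum τ, hsum1] at hclip
  change energy I α (fun j => y (τ j)) + _ ≤ energy I α y + _ at hclip
  have hle : ∑ j, (α j : ℝ) * J j ≤ (energy I α y).toReal := by
    rw [← ENNReal.ofReal_le_iff_le_toReal hy, ← hsum1]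
    refine Finset.sum_le_sum fun j _ => ?_
    gcongr
    exact min_le_left _ _
  have hτy : energy I α (fun j => y (τ j)) ≠ ∞ := ne_top_of_le_ne_top hy (by simpa using hmin 1)
  have hreal : (energy I α (fun j => y (τ j))).toReal + ∑ j, (α j : ℝ) * J j
      ≤ (energy I α y).toReal + ∑ j, (α j : ℝ) * J (τ j) := by
    have hn : ∀ π : Equiv.Perm (Fin K), 0 ≤ ∑ j, (α j : ℝ) * (J (π j) : ℝ) := fun π =>
      Finset.sum_nonneg fun j _ => by positivity
    have hn1 := hn 1
    simp only [Equiv.Perm.coe_one, id_eq] at hn1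
    have := ENNReal.toReal_mono (ENNReal.add_ne_top.2 ⟨hy, ENNReal.ofReal_ne_top⟩) hclip
    rwa [ENNReal.toReal_add hτy ENNReal.ofReal_ne_top, ENNReal.toReal_add hy ENNReal.ofReal_ne_top,
      ENNReal.toReal_ofReal hn1, ENNReal.toReal_ofReal (hn τ)] at this
  linarith

lemma expNeg_div_ofReal {ε : ℝ} (hε : 0 < ε) {t : ℝ≥0∞} (ht : t ≠ ∞) :
    expNeg (t / ENNReal.ofReal ε) = ENNReal.ofReal (Real.exp (-t.toReal / ε)) := by
  lift t to ℝ≥0 using ht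
  exact expNeg_coe_div hε t

/-- The right side involves the energy of x itself, not of x_σ, because it must match the product
Gibbs density in the original order. -/
lemma weight_mul_sq_le (hα1 : α 0 = 1) (hα : Antitone α) {v m : ℝ}
    (hv : (v : EReal) ≤ decayRate I F α) (hm : ∀ x, m ≤ F x) {ε θ : ℝ} (hε : 0 < ε)
    (hθ : 0 < θ) (hθ1 : θ < 1) (x : Fin K → 𝒳) (σ : Equiv.Perm (Fin K)) :
    (weight I α ε (fun j => x (σ j)) * ENNReal.ofReal (Real.exp (-F (x (σ 0)) / ε))) ^ 2
      ≤ ENNReal.ofReal (Real.exp (-((1 - θ) * v + 2 * θ * m) / ε)) *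
        (expNeg (ENNReal.ofReal (1 - θ) * (energy I α x / ENNReal.ofReal ε)))⁻¹ := by
  have hc0 : ENNReal.ofReal (1 - θ) ≠ 0 := by simpa using hθ1
  by_cases hx : energy I α x = ∞
  · rw [hx, ENNReal.top_div_of_ne_top ENNReal.ofReal_ne_top, ENNReal.mul_top hc0, expNeg_top,
      ENNReal.inv_zero, ENNReal.mul_top (by simpa using Real.exp_pos _)]
    exact le_top
  by_cases hy : energy I α (fun j => x (σ j)) = ∞
  · have : weight I α ε (fun j => x (σ j)) = 0 := by
      rw [weight, hy, ENNReal.top_div_of_ne_top ENNReal.ofReal_ne_top, expNeg_top,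
        ENNReal.zero_div]
    simp [this]
  obtain ⟨τ, hmin, hle⟩ := exists_perm_decayRate_le hα1 hα hv hy
  have hMx : energy I α (fun j => x (σ (τ j))) ≤ energy I α x := by
    simpa using hmin σ.symm
  have hMy : energy I α (fun j => x (σ (τ j))) ≤ energy I α (fun j => x (σ j)) := by
    simpa using hmin 1
  have hM : energy I α (fun j => x (σ (τ j))) ≠ ∞ := ne_top_of_le_ne_top hx hMx
  have hMx' := ENNReal.toReal_mono hx hMx
  have hMy' := ENNReal.toReal_mono hy hMy
  set E := (energy I α (fun j => x (σ j))).toReal with hE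
  set M := (energy I α (fun j => x (σ (τ j)))).toReal with hMdef
  set Ex := (energy I α x).toReal with hEx
  set f := F (x (σ 0)) with hf
  -- Only the minimal-energy term of the denominator is kept.
  have hw : weight I α ε (fun j => x (σ j)) ≤ ENNReal.ofReal (Real.exp ((M - E) / ε)) := by
    unfold weight
    calc _ ≤ expNeg (energy I α (fun j => x (σ j)) / ENNReal.ofReal ε) /
          expNeg (energy I α (fun j => x (σ (τ j))) / ENNReal.ofReal ε) := by
          gcongr
          exact Finset.single_le_sum
            (f := fun π : Equiv.Perm (Fin K) =>
              expNeg (energy I α (fun j => x (σ (π j))) / ENNReal.ofReal ε))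
            (fun _ _ => zero_le) (Finset.mem_univ τ)
      _ = _ := by
          rw [expNeg_div_ofReal hε hy, expNeg_div_ofReal hε hM,
            ← ENNReal.ofReal_div_of_pos (Real.exp_pos _), ← Real.exp_sub]
          congr 2
          ring
  have hrhs : (expNeg (ENNReal.ofReal (1 - θ) * (energy I α x / ENNReal.ofReal ε)))⁻¹
      = ENNReal.ofReal (Real.exp ((1 - θ) * Ex / ε)) := by
    rw [← mul_div_assoc, expNeg_div_ofReal hε (ENNReal.mul_ne_top ENNReal.ofReal_ne_top hx),
      ← ENNReal.ofReal_inv_of_pos (Real.exp_pos _), ← Real.exp_neg, ENNReal.toReal_mul,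
      ENNReal.toReal_ofReal (by linarith)]
    congr 2
    ring
  -- A fraction 1 - θ of the exponent uses the decay rate and M ≤ Ex; the fraction θ uses only M ≤ E
  -- and m ≤ f.
  have hexp : 2 * ((M - E) / ε + -f / ε)
      ≤ -((1 - θ) * v + 2 * θ * m) / ε + (1 - θ) * Ex / ε := by
    rw [← add_div, ← add_div, ← mul_div_assoc]
    refine div_le_div_of_nonneg_right ?_ hε.le
    have h1 : (1 - θ) * v ≤ (1 - θ) * (2 * E - M + 2 * f) :=
      mul_le_mul_of_nonneg_left hle (by linarith)
    have h2 : θ * (2 * m) ≤ θ * (2 * f) :=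
      mul_le_mul_of_nonneg_left (by linarith [hm (x (σ 0))]) hθ.le
    have h3 : θ * M ≤ θ * E := mul_le_mul_of_nonneg_left hMy' hθ.le
    have h4 : (1 - θ) * M ≤ (1 - θ) * Ex := mul_le_mul_of_nonneg_left hMx' (by linarith)
    linarith
  calc _ ≤ (ENNReal.ofReal (Real.exp ((M - E) / ε)) *
        ENNReal.ofReal (Real.exp (-f / ε))) ^ 2 := by gcongr
    _ = ENNReal.ofReal (Real.exp (2 * ((M - E) / ε + -f / ε))) := by
        rw [ofReal_exp_mul, ofReal_exp_pow]; norm_num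
    _ ≤ ENNReal.ofReal (Real.exp
          (-((1 - θ) * v + 2 * θ * m) / ε + (1 - θ) * Ex / ε)) :=
        ENNReal.ofReal_le_ofReal (Real.exp_le_exp.2 hexp)
    _ = _ := by rw [hrhs, ofReal_exp_mul]

lemma estimator_sq_le (hα1 : α 0 = 1) (hα : Antitone α) {v m : ℝ}
    (hv : (v : EReal) ≤ decayRate I F α) (hm : ∀ x, m ≤ F x) {ε θ : ℝ} (hε : 0 < ε)
    (hθ : 0 < θ) (hθ1 : θ < 1) (x : Fin K → 𝒳) :
    estimator I F α ε x ^ 2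
      ≤ (Fintype.card (Equiv.Perm (Fin K)) : ℝ≥0∞) ^ 2 *
        (ENNReal.ofReal (Real.exp (-((1 - θ) * v + 2 * θ * m) / ε)) *
          ∏ j, (expNeg (ENNReal.ofReal (1 - θ) * (α j * I (x j) / ENNReal.ofReal ε)))⁻¹) := by
  obtain ⟨σ, -, hσ⟩ := Finset.exists_max_image Finset.univ (fun σ : Equiv.Perm (Fin K) =>
    weight I α ε (fun j => x (σ j)) * ENNReal.ofReal (Real.exp (-F (x (σ 0)) / ε)))
    Finset.univ_nonempty
  have h1 : estimator I F α ε x ≤ (Fintype.card (Equiv.Perm (Fin K)) : ℝ≥0∞) *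
      (weight I α ε (fun j => x (σ j)) * ENNReal.ofReal (Real.exp (-F (x (σ 0)) / ε))) := by
    refine (Finset.sum_le_card_nsmul _ _ _ hσ).trans ?_
    simp
  have h2 : (expNeg (ENNReal.ofReal (1 - θ) * (energy I α x / ENNReal.ofReal ε)))⁻¹
      = ∏ j, (expNeg (ENNReal.ofReal (1 - θ) * (α j * I (x j) / ENNReal.ofReal ε)))⁻¹ := by
    have : ENNReal.ofReal (1 - θ) * (energy I α x / ENNReal.ofReal ε)
        = ∑ j, ENNReal.ofReal (1 - θ) * (α j * I (x j) / ENNReal.ofReal ε) := by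
      simp only [energy, div_eq_mul_inv, Finset.sum_mul, Finset.mul_sum]
    rw [this, expNeg_sum, ENNReal.prod_inv_distrib]
    exact fun _ _ _ _ _ => Or.inr (expNeg_ne_top _)
  rw [← h2]
  calc _ ≤ _ := pow_le_pow_left₀ zero_le h1 2
    _ = _ := mul_pow _ _ _
    _ ≤ _ := by
      gcongr
      exact weight_mul_sq_le hα1 hα hv hm hε hθ hθ1 x σ

variable [MeasurableSpace 𝒳] {γ : Measure 𝒳}

lemma lintegral_estimator_sq_le (hI : Measurable I) (hα1 : α 0 = 1) (hα : Antitone α) {v m : ℝ}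
    (hv : (v : EReal) ≤ decayRate I F α) (hm : ∀ x, m ≤ F x) {ε θ : ℝ} (hε : 0 < ε)
    (hθ : 0 < θ) (hθ1 : θ < 1) {Ω : Type*} [MeasurableSpace Ω] {P : Measure Ω}
    {X : Fin K → Ω → 𝒳} (hX : ∀ j, Measurable (X j)) (hindep : iIndepFun X P)
    (hlaw : ∀ j, HasLaw (X j) (gibbsMeasure γ I (ENNReal.ofReal ε / (α j : ℝ≥0∞))) P) :
    ∫⁻ ω, estimator I F α ε (fun j => X j ω) ^ 2 ∂P
      ≤ (Fintype.card (Equiv.Perm (Fin K)) : ℝ≥0∞) ^ 2 *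
        (ENNReal.ofReal (Real.exp (-((1 - θ) * v + 2 * θ * m) / ε)) *
          ∏ j, ((partitionFunction γ I (ENNReal.ofReal ε / α j))⁻¹ *
            partitionFunction γ I (ENNReal.ofReal (ε / θ) / α j))) := by
  set g : Fin K → 𝒳 → ℝ≥0∞ := fun j x =>
    (expNeg (ENNReal.ofReal (1 - θ) * (α j * I x / ENNReal.ofReal ε)))⁻¹ with hg
  have hgm : ∀ j, Measurable (g j) := fun j =>
    (measurable_expNeg.comp (((hI.const_mul _).div_const _).const_mul _)).inv
  have hgX : ∀ j, Measurable (g j ∘ X j) := fun j => (hgm j).comp (hX j)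
  calc _ ≤ ∫⁻ ω, (Fintype.card (Equiv.Perm (Fin K)) : ℝ≥0∞) ^ 2 *
        (ENNReal.ofReal (Real.exp (-((1 - θ) * v + 2 * θ * m) / ε)) *
          ∏ j, (g j ∘ X j) ω) ∂P :=
        lintegral_mono fun ω => estimator_sq_le hα1 hα hv hm hε hθ hθ1 fun j => X j ω
    _ = (Fintype.card (Equiv.Perm (Fin K)) : ℝ≥0∞) ^ 2 *
        (ENNReal.ofReal (Real.exp (-((1 - θ) * v + 2 * θ * m) / ε)) *
          ∏ j, ∫⁻ ω, (g j ∘ X j) ω ∂P) := by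
        have hp : Measurable fun ω => ∏ j, (g j ∘ X j) ω :=
          Finset.measurable_fun_prod _ fun j _ => hgX j
        rw [lintegral_const_mul _ (hp.const_mul _), lintegral_const_mul _ hp,
          lintegral_prod_eq_prod_lintegral_of_indepFun _ _ (hindep.comp g hgm) hgX]
    _ ≤ _ := by
        gcongr with j
        refine le_of_eq_of_le ?_ (lintegral_inv_expNeg_le hI hε hθ hθ1 (α j))
        rw [← (hlaw j).map_eq, lintegral_map (hgm j) (hX j)]
        rfl

end UpperBound

/-! ### Lower bound on the second moment. -/

section LowerBound

variable {𝒳 : Type*} {K : ℕ} {I : 𝒳 → ℝ≥0∞} {F : 𝒳 → ℝ} {α : Fin K → ℝ≥0}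

lemma energy_ne_top {x : Fin K → 𝒳} (hx : ∀ j, I (x j) ≠ ∞) : energy I α x ≠ ∞ :=
  ENNReal.sum_ne_top.2 fun j _ => ENNReal.mul_ne_top ENNReal.coe_ne_top (hx j)

lemma toReal_energy {x : Fin K → 𝒳} (hx : ∀ j, I (x j) ≠ ∞) :
    (energy I α x).toReal = ∑ j, (α j : ℝ) * (I (x j)).toReal := by
  rw [energy, ENNReal.toReal_sum fun j _ => ENNReal.mul_ne_top ENNReal.coe_ne_top (hx j)]
  simp

lemma sum_mul_le_sum_mul_add (hα : ∀ j, α j ≤ 1) {u w : Fin K → ℝ} {d : ℝ} (hd : 0 ≤ d)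
    (h : ∀ j, u j ≤ w j + d) : ∑ j, (α j : ℝ) * u j ≤ ∑ j, (α j : ℝ) * w j + K * d := by
  have : ∑ j, (α j : ℝ) * u j ≤ ∑ j, ((α j : ℝ) * w j + d) := by
    refine Finset.sum_le_sum fun j _ => ?_
    have h1 : (α j : ℝ) ≤ 1 := by exact_mod_cast hα j
    calc (α j : ℝ) * u j ≤ (α j : ℝ) * (w j + d) :=
          mul_le_mul_of_nonneg_left (h j) (by positivity)
      _ = (α j : ℝ) * w j + α j * d := by ring
      _ ≤ _ := by gcongr; exact mul_le_of_le_one_left hd h1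
  refine this.trans (le_of_eq ?_)
  simp [Finset.sum_add_distrib]

/-- Since α_j ≤ 1, errors d in the energies move each weighted sum by at most Kd. The numerator and
the sorted minimum bounding the denominator both contribute, giving 2Kd. -/
lemma le_weight (hα : Antitone α) (hα' : ∀ j, α j ≤ 1) {J : Fin K → ℝ≥0}
    {σ : Equiv.Perm (Fin K)} (hσ : Monotone (J ∘ σ)) {d : ℝ} (hd : 0 ≤ d) {ε : ℝ} (hε : 0 < ε)
    {y : Fin K → 𝒳} (hy : ∀ j, I (y j) ≠ ∞) (hyJ : ∀ j, |(I (y j)).toReal - J j| ≤ d) :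
    (Fintype.card (Equiv.Perm (Fin K)) : ℝ≥0∞)⁻¹ * ENNReal.ofReal (Real.exp
        (-(∑ j, (α j : ℝ) * J j - ∑ j, (α j : ℝ) * J (σ j) + 2 * K * d) / ε))
      ≤ weight I α ε y := by
  set E := ∑ j, (α j : ℝ) * (J j : ℝ)
  set M := ∑ j, (α j : ℝ) * (J (σ j) : ℝ)
  have hnum : ENNReal.ofReal (Real.exp (-(E + K * d) / ε))
      ≤ expNeg (energy I α y / ENNReal.ofReal ε) := by
    rw [expNeg_div_ofReal hε (energy_ne_top hy), toReal_energy hy]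
    gcongr
    exact sum_mul_le_sum_mul_add hα' hd fun j => by linarith [(abs_le.1 (hyJ j)).2]
  have hden : ∑ τ : Equiv.Perm (Fin K),
      expNeg (energy I α (fun j => y (τ j)) / ENNReal.ofReal ε)
      ≤ (Fintype.card (Equiv.Perm (Fin K)) : ℝ≥0∞) *
        ENNReal.ofReal (Real.exp (-(M - K * d) / ε)) := by
    refine (Finset.sum_le_card_nsmul _ _ (ENNReal.ofReal (Real.exp (-(M - K * d) / ε)))
      fun τ _ => ?_).trans (by simp)
    have hyτ : ∀ j, I (y (τ j)) ≠ ∞ := fun j => hy _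
    rw [expNeg_div_ofReal hε (energy_ne_top hyτ), toReal_energy hyτ]
    gcongr
    have h1 : M ≤ ∑ j, (α j : ℝ) * (J (τ j) : ℝ) :=
      sum_mul_comp_perm_le_real hα (f := fun j => (J j : ℝ))
        (fun i j hij => by exact_mod_cast hσ hij) τ
    have h2 := sum_mul_le_sum_mul_add hα' hd (u := fun j => (J (τ j) : ℝ))
      (w := fun j => (I (y (τ j))).toReal) fun j => by linarith [(abs_le.1 (hyJ (τ j))).1]
    linarith
  unfold weight
  refine le_trans (le_of_eq ?_) (ENNReal.div_le_div hnum hden)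
  rw [ENNReal.div_eq_inv_mul, ENNReal.mul_inv (by simp) (by simp),
    mul_assoc (Fintype.card (Equiv.Perm (Fin K)) : ℝ≥0∞)⁻¹,
    ← ENNReal.ofReal_inv_of_pos (Real.exp_pos _), ← Real.exp_neg, ofReal_exp_mul]
  congr 4
  ring

variable [NeZero K]

lemma le_estimator_sq (hα : Antitone α) (hα' : ∀ j, α j ≤ 1) {J : Fin K → ℝ≥0}
    {σ : Equiv.Perm (Fin K)} (hσ : Monotone (J ∘ σ)) {d : ℝ} (hd : 0 ≤ d) {ε : ℝ} (hε : 0 < ε)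
    {f : ℝ} {x : Fin K → 𝒳} (hx : ∀ j, I (x j) ≠ ∞)
    (hxJ : ∀ j, |(I (x j)).toReal - J (σ j)| ≤ d) (hxF : F (x (σ.symm 0)) ≤ f + d) :
    (Fintype.card (Equiv.Perm (Fin K)) : ℝ≥0∞)⁻¹ ^ 2 * ENNReal.ofReal (Real.exp
        (-(2 * ∑ j, (α j : ℝ) * J j - 2 * ∑ j, (α j : ℝ) * J (σ j) + 2 * f
          + (4 * K + 2) * d) / ε))
      ≤ estimator I F α ε x ^ 2 := by
  have h1 := le_weight hα hα' hσ hd hε (y := fun j => x (σ.symm j)) (fun j => hx _)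
    (fun j => by simpa using hxJ (σ.symm j))
  have h2 : ENNReal.ofReal (Real.exp (-(f + d) / ε))
      ≤ ENNReal.ofReal (Real.exp (-F (x (σ.symm 0)) / ε)) := by gcongr
  have h3 : weight I α ε (fun j => x (σ.symm j)) *
      ENNReal.ofReal (Real.exp (-F (x (σ.symm 0)) / ε)) ≤ estimator I F α ε x :=
    Finset.single_le_sum (f := fun τ : Equiv.Perm (Fin K) => weight I α ε (fun j => x (τ j)) *
      ENNReal.ofReal (Real.exp (-F (x (τ 0)) / ε))) (fun _ _ => zero_le) (Finset.mem_univ σ.symm)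
  refine le_trans (le_of_eq ?_) (pow_le_pow_left₀ zero_le ((mul_le_mul' h1 h2).trans h3) 2)
  rw [mul_assoc, ofReal_exp_mul, mul_pow, ofReal_exp_pow]
  congr 3
  push_cast
  ring

variable [MeasurableSpace 𝒳] {γ : Measure 𝒳}

/-- The sample is restricted to X_j in A(σ j), the cheapest assignment; the permutation inverse to σ
restores the order J in the estimator. The error (5K + 2)d is (4K + 2)d from the squared estimator
plus Kd from the probability. -/
lemma le_lintegral_estimator_sq (hα : Antitone α) (hα' : ∀ j, α j ≤ 1)
    {J : Fin K → ℝ≥0} {σ : Equiv.Perm (Fin K)} (hσ : Monotone (J ∘ σ)) {d : ℝ≥0} {ε : ℝ}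
    (hε : 0 < ε) {f : ℝ} {A : Fin K → Set 𝒳} (hA : ∀ j, MeasurableSet (A j))
    (hAJ : ∀ j, ∀ y ∈ A j, I y ≠ ∞ ∧ |(I y).toReal - J j| ≤ d) (hAF : ∀ y ∈ A 0, F y ≤ f + d)
    {Ω : Type*} [MeasurableSpace Ω] {P : Measure Ω}
    {X : Fin K → Ω → 𝒳} (hX : ∀ j, Measurable (X j)) (hindep : iIndepFun X P)
    (hlaw : ∀ j, HasLaw (X j) (gibbsMeasure γ I (ENNReal.ofReal ε / (α j : ℝ≥0∞))) P) :
    (Fintype.card (Equiv.Perm (Fin K)) : ℝ≥0∞)⁻¹ ^ 2 *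
        ENNReal.ofReal (Real.exp (-(objective α J f + (5 * K + 2) * d) / ε)) *
        ∏ j, ((partitionFunction γ I (ENNReal.ofReal ε / α j))⁻¹ * γ (A (σ j)))
      ≤ ∫⁻ ω, estimator I F α ε (fun j => X j ω) ^ 2 ∂P := by
  set E := ∑ j, (α j : ℝ) * (J j : ℝ) with hE
  set M := ∑ j, (α j : ℝ) * (J (σ j) : ℝ) with hM
  have hd : (0 : ℝ) ≤ d := d.2
  have hmeas : ∀ j, P (X j ⁻¹' A (σ j))
      = gibbsMeasure γ I (ENNReal.ofReal ε / (α j : ℝ≥0∞)) (A (σ j)) := fun j => by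
    rw [← (hlaw j).map_eq, Measure.map_apply (hX j) (hA _)]
  set S : Set Ω := ⋂ j ∈ (Finset.univ : Finset (Fin K)), X j ⁻¹' A (σ j) with hS
  have hSm : MeasurableSet S := Finset.measurableSet_biInter _ fun j _ => hX j (hA _)
  have hPS : ENNReal.ofReal (Real.exp (-(M + K * d) / ε)) *
      ∏ j, ((partitionFunction γ I (ENNReal.ofReal ε / α j))⁻¹ * γ (A (σ j))) ≤ P S := by
    rw [hS, hindep.measure_inter_preimage_eq_mul _ fun j _ => hA (σ j)]
    have h1 : ENNReal.ofReal (Real.exp (-(M + K * d) / ε))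
        ≤ ∏ j, ENNReal.ofReal (Real.exp (-((α j : ℝ) * (J (σ j) + d : ℝ≥0)) / ε)) := by
      rw [← ENNReal.ofReal_prod_of_nonneg fun j _ => Real.exp_nonneg _, ← Real.exp_sum,
        ← Finset.sum_div, Finset.sum_neg_distrib]
      gcongr
      refine sum_mul_le_sum_mul_add hα' hd fun j => ?_
      push_cast
      exact le_rfl
    calc _ ≤ (∏ j, ENNReal.ofReal (Real.exp (-((α j : ℝ) * (J (σ j) + d : ℝ≥0)) / ε))) *
          ∏ j, ((partitionFunction γ I (ENNReal.ofReal ε / α j))⁻¹ * γ (A (σ j))) := by gcongr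
      _ = ∏ j, ((partitionFunction γ I (ENNReal.ofReal ε / α j))⁻¹ *
          (ENNReal.ofReal (Real.exp (-((α j : ℝ) * (J (σ j) + d : ℝ≥0)) / ε)) *
            γ (A (σ j)))) := by
          rw [← Finset.prod_mul_distrib]
          exact Finset.prod_congr rfl fun j _ => by ring
      _ ≤ _ := by
          refine Finset.prod_le_prod' fun j _ => ?_
          rw [hmeas]
          refine le_gibbsMeasure hε (α j) (J (σ j) + d) (hA _) fun y hy => ?_
          obtain ⟨h2, h3⟩ := hAJ _ y hy
          rw [← ENNReal.ofReal_toReal h2, ← ENNReal.ofReal_coe_nnreal]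
          refine ENNReal.ofReal_le_ofReal ?_
          push_cast
          linarith [(abs_le.1 h3).2]
  set c : ℝ≥0∞ := (Fintype.card (Equiv.Perm (Fin K)) : ℝ≥0∞)⁻¹ ^ 2 * ENNReal.ofReal (Real.exp
    (-(2 * E - 2 * M + 2 * f + (4 * K + 2) * d) / ε)) with hc
  have hpt : ∀ ω ∈ S, c ≤ estimator I F α ε (fun j => X j ω) ^ 2 := by
    intro ω hω
    have hω' : ∀ j, X j ω ∈ A (σ j) := by simpa [hS] using hω
    refine le_estimator_sq hα hα' hσ hd hε (fun j => (hAJ _ _ (hω' j)).1)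
      (fun j => (hAJ _ _ (hω' j)).2) (hAF _ ?_)
    simpa using hω' (σ.symm 0)
  calc _ = c * (ENNReal.ofReal (Real.exp (-(M + K * d) / ε)) *
        ∏ j, ((partitionFunction γ I (ENNReal.ofReal ε / α j))⁻¹ * γ (A (σ j)))) := by
        rw [hc, ← mul_assoc, mul_assoc _ (ENNReal.ofReal _) (ENNReal.ofReal _), ofReal_exp_mul,
          objective_eq_of_monotone hα hσ, ← hE, ← hM]
        congr 4
        ring
    _ ≤ c * P S := by gcongr
    _ = ∫⁻ _ in S, c ∂P := (setLIntegral_const _ _).symm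
    _ ≤ ∫⁻ ω in S, estimator I F α ε (fun j => X j ω) ^ 2 ∂P := setLIntegral_mono' hSm hpt
    _ ≤ _ := setLIntegral_le_lintegral _ _

end LowerBound

/-! ### Finiteness and near-minimizers of the decay rate. -/

section DecayRate

variable {𝒳 : Type*} {K : ℕ} [NeZero K] {I : 𝒳 → ℝ≥0∞} {F : 𝒳 → ℝ} {α : Fin K → ℝ≥0}

lemma two_mul_le_decayRate {m : ℝ} (hm : ∀ x, m ≤ F x) :
    ((2 * m : ℝ) : EReal) ≤ decayRate I F α := by
  refine le_iInf fun J => le_iInf fun f => le_iInf fun hJf => le_iInf fun _ => ?_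
  obtain ⟨x, hx⟩ := hJf
  have hf : m ≤ f := by
    rw [← (Prod.mk.inj hx).2]
    exact hm x
  have h1 : Finset.univ.inf' Finset.univ_nonempty
      (fun σ : Equiv.Perm (Fin K) => ∑ j, (α j : ℝ) * (J (σ j) : ℝ)) ≤ ∑ j, (α j : ℝ) * (J j : ℝ) :=
    (Finset.inf'_le _ (Finset.mem_univ (1 : Equiv.Perm (Fin K)))).trans (by simp)
  have h2 : 0 ≤ ∑ j, (α j : ℝ) * (J j : ℝ) := Finset.sum_nonneg fun j _ => by positivity
  refine EReal.coe_le_coe_iff.2 ?_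
  unfold objective
  linarith

lemma decayRate_ne_top {x : 𝒳} (hx : I x ≠ ∞) : decayRate I F α ≠ ⊤ := by
  have : decayRate I F α ≤ (objective α (fun _ => (I x).toNNReal) (F x) : EReal) :=
    iInf_le_of_le _ (iInf_le_of_le (F x) (iInf_le_of_le ⟨x, by simp [ENNReal.coe_toNNReal hx]⟩
      (iInf_le_of_le (fun _ => le_rfl) le_rfl)))
  exact ne_top_of_le_ne_top (EReal.coe_ne_top _) this

/-- Only the values 0 and J_0 = I(a) are used, the two that I is known to attain or approach. -/
lemma exists_of_decayRate_lt (hα : Antitone α) {r : ℝ} (hr : decayRate I F α < r) :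
    ∃ (J : Fin K → ℝ≥0) (a : 𝒳), I a = J 0 ∧ (∀ j, J j = 0 ∨ J j = J 0) ∧
      objective α J (F a) < r := by
  simp only [decayRate, iInf_lt_iff] at hr
  obtain ⟨J, f, ⟨a, ha⟩, hJ, hlt⟩ := hr
  obtain ⟨h1, rfl⟩ := Prod.mk.inj ha
  obtain ⟨J', h0, hJ', hle⟩ := exists_objective_indicator_le hα hJ (F a)
  exact ⟨J', a, by rw [h1, h0], by rwa [h0], hle.trans_lt (EReal.coe_lt_coe_iff.1 hlt)⟩

end DecayRate

lemma tendsto_neg_mul_log {Q : ℝ → ℝ≥0∞} {v : ℝ}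
    (hupper : ∀ r < v, ∀ᶠ ε : ℝ in 𝓝[>] 0, Q ε ≤ ENNReal.ofReal (Real.exp (-r / ε)))
    (hlower : ∀ r > v, ∀ᶠ ε : ℝ in 𝓝[>] 0, ENNReal.ofReal (Real.exp (-r / ε)) ≤ Q ε) :
    Tendsto (fun ε : ℝ => -(ε : EReal) * ENNReal.log (Q ε)) (𝓝[>] 0) (𝓝 (v : EReal)) := by
  have hexp : ∀ r ε : ℝ, 0 < ε →
      (ε : EReal) * ENNReal.log (ENNReal.ofReal (Real.exp (-r / ε))) = ((-r : ℝ) : EReal) := by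
    intro r ε hε
    rw [ENNReal.log_ofReal_of_pos (Real.exp_pos _), Real.log_exp, ← EReal.coe_mul,
      mul_div_cancel₀ _ hε.ne']
  refine tendsto_order.2 ⟨fun a ha => ?_, fun a ha => ?_⟩
  · obtain ⟨r, har, hrv⟩ := EReal.lt_iff_exists_real_btwn.1 ha
    filter_upwards [hupper r (EReal.coe_lt_coe_iff.1 hrv), self_mem_nhdsWithin] with ε h1 hε
    have h2 := mul_le_mul_of_nonneg_left (ENNReal.log_le_log h1)
      (EReal.coe_nonneg.2 (le_of_lt hε))
    rw [hexp r ε hε, EReal.coe_neg] at h2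
    rw [EReal.neg_mul]
    exact har.trans_le (EReal.le_neg_of_le_neg h2)
  · obtain ⟨r, hrv, har⟩ := EReal.lt_iff_exists_real_btwn.1 ha
    filter_upwards [hlower r (EReal.coe_lt_coe_iff.1 hrv), self_mem_nhdsWithin] with ε h1 hε
    have h2 := mul_le_mul_of_nonneg_left (ENNReal.log_le_log h1)
      (EReal.coe_nonneg.2 (le_of_lt hε))
    rw [hexp r ε hε, EReal.coe_neg] at h2
    rw [EReal.neg_mul]
    exact (EReal.neg_le_of_neg_le h2).trans_lt har

/-! ### Exponential estimates as ε ↓ 0. -/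

section Main

variable {𝒳 : Type*} [TopologicalSpace 𝒳] [MeasurableSpace 𝒳] [BorelSpace 𝒳]
  {γ : Measure 𝒳} {I : 𝒳 → ℝ≥0∞}

lemma GibbsLDP.measure_sublevel_ne_zero (h : GibbsLDP γ I) (hI : ContinuousOn I {x | I x < ∞})
    {d : ℝ≥0} (hd : 0 < d) : γ {x | I x ≤ d} ≠ 0 := by
  obtain ⟨x, hx⟩ := h.exists_lt (half_pos hd)
  refine fun h0 => h.measure_near_ne_zero hI (F := fun _ => 0) continuous_const
    (hx.trans ENNReal.coe_lt_top) (half_pos hd) (measure_mono_null (fun y hy => ?_) h0)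
  refine hy.2.1.trans ?_
  calc I x + (d / 2 : ℝ≥0) ≤ (d / 2 : ℝ≥0) + (d / 2 : ℝ≥0) := by gcongr
    _ = d := by rw [← ENNReal.coe_add, add_halves]

variable [T2Space 𝒳] {F : 𝒳 → ℝ} {K : ℕ} [NeZero K] {α : Fin K → ℝ≥0}
  {Ω : ℝ → Type*} [∀ ε, MeasurableSpace (Ω ε)] {P : ∀ ε, Measure (Ω ε)}
  {X : ∀ ε, Fin K → Ω ε → 𝒳}

lemma eventually_lintegral_estimator_sq_le (hμ : GibbsLDP γ I)
    (hI : ContinuousOn I {x | I x < ∞}) (hFb : BddBelow (Set.range F)) (hα1 : α 0 = 1)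
    (hα : Antitone α) (hX : ∀ ε : ℝ, 0 < ε → ∀ j, Measurable (X ε j))
    (hindep : ∀ ε : ℝ, 0 < ε → iIndepFun (X ε) (P ε))
    (hprob : ∀ ε : ℝ, 0 < ε → ∀ j,
      IsProbabilityMeasure (gibbsMeasure γ I (ENNReal.ofReal ε / (α j : ℝ≥0∞))))
    (hlaw : ∀ ε : ℝ, 0 < ε → ∀ j,
      HasLaw (X ε j) (gibbsMeasure γ I (ENNReal.ofReal ε / (α j : ℝ≥0∞))) (P ε))
    {v : ℝ} (hv : (v : EReal) ≤ decayRate I F α) {r : ℝ} (hr : r < v) :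
    ∀ᶠ ε : ℝ in 𝓝[>] 0, ∫⁻ ω, estimator I F α ε (fun j => X ε j ω) ^ 2 ∂(P ε)
      ≤ ENNReal.ofReal (Real.exp (-r / ε)) := by
  obtain ⟨m, hm⟩ := hFb
  replace hm : ∀ x, m ≤ F x := fun x => hm ⟨x, rfl⟩
  have hIm : Measurable I := hμ.ldp.measurable
  have hα' : ∀ j, α j ≤ 1 := fun j => hα1 ▸ hα (Fin.zero_le j)
  have hK : (0 : ℝ) < K := by exact_mod_cast Nat.pos_of_ne_zero (NeZero.ne K)
  -- The gap v - r is spent in thirds: on θ, on the K inverse normalizers via d, and on the constant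
  -- C.
  obtain ⟨θ, hθ, hθ1, hθv⟩ : ∃ θ : ℝ, 0 < θ ∧ θ < 1 ∧ θ * (v - 2 * m) ≤ (v - r) / 3 := by
    have hpos : 0 < 3 * (|v - 2 * m| + 1) := by positivity
    have hvr : 0 < v - r := by linarith
    refine ⟨min (1 / 2) ((v - r) / (3 * (|v - 2 * m| + 1))), by positivity,
      (min_le_left _ _).trans_lt (by norm_num), ?_⟩
    calc _ ≤ min (1 / 2) ((v - r) / (3 * (|v - 2 * m| + 1))) * (|v - 2 * m| + 1) := by
          gcongr
          linarith [le_abs_self (v - 2 * m)]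
      _ ≤ (v - r) / (3 * (|v - 2 * m| + 1)) * (|v - 2 * m| + 1) := by
          gcongr
          exact min_le_right _ _
      _ = (v - r) / 3 := by field_simp
  obtain ⟨d, hd, hdv⟩ : ∃ d : ℝ≥0, 0 < d ∧ (K : ℝ) * d = (v - r) / 3 := by
    refine ⟨⟨(v - r) / 3 / K, by have : 0 < v - r := by linarith
                                 positivity⟩, ?_, ?_⟩
    · have : (0 : ℝ) < (v - r) / 3 / K := div_pos (by linarith) hK
      exact_mod_cast this
    · change _ * (_ / _) = _
      field_simp
  set g := γ {x | I x ≤ d} with hg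
  have hg0 : g ≠ 0 := hμ.measure_sublevel_ne_zero hI hd
  set C : ℝ≥0∞ := (Fintype.card (Equiv.Perm (Fin K)) : ℝ≥0∞) ^ 2 *
    ∏ j, (g⁻¹ * partitionFunction γ I (ENNReal.ofReal (1 / θ) / α j)) with hC
  have hCtop : C ≠ ∞ := by
    refine ENNReal.mul_ne_top (by simp) (ENNReal.prod_ne_top fun j _ => ENNReal.mul_ne_top
      (ENNReal.inv_ne_top.2 hg0) (partitionFunction_ne_top (hprob _ (by positivity) j)))
  filter_upwards [eventually_le_exp_div hCtop (show 0 < (v - r) / 3 by linarith),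
    Ioc_mem_nhdsGT (zero_lt_one (α := ℝ))] with ε hCε ⟨hε, hε1⟩
  have hZ : ∀ j, (partitionFunction γ I (ENNReal.ofReal ε / α j))⁻¹ *
      partitionFunction γ I (ENNReal.ofReal (ε / θ) / α j)
      ≤ ENNReal.ofReal (Real.exp (d / ε)) *
        (g⁻¹ * partitionFunction γ I (ENNReal.ofReal (1 / θ) / α j)) := by
    intro j
    rw [← mul_assoc]
    refine mul_le_mul' ?_ (partitionFunction_mono (by gcongr))
    have h1 := le_partitionFunction (γ := γ) hε (hα' j) d (hIm measurableSet_Iic)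
      (A := {x | I x ≤ d}) fun x hx => hx
    refine (ENNReal.inv_le_inv.2 h1).trans (le_of_eq ?_)
    rw [ENNReal.mul_inv (Or.inl (by simpa using Real.exp_pos _)) (Or.inl ENNReal.ofReal_ne_top),
      ← ENNReal.ofReal_inv_of_pos (Real.exp_pos _), ← Real.exp_neg, neg_div, neg_neg]
  refine (lintegral_estimator_sq_le hIm hα1 hα hv hm hε hθ hθ1 (hX ε hε) (hindep ε hε)
    (hlaw ε hε)).trans ?_
  calc _ ≤ (Fintype.card (Equiv.Perm (Fin K)) : ℝ≥0∞) ^ 2 *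
        (ENNReal.ofReal (Real.exp (-((1 - θ) * v + 2 * θ * m) / ε)) *
          ∏ j, (ENNReal.ofReal (Real.exp (d / ε)) *
            (g⁻¹ * partitionFunction γ I (ENNReal.ofReal (1 / θ) / α j)))) := by
        exact mul_le_mul' le_rfl (mul_le_mul' le_rfl (Finset.prod_le_prod' fun j _ => hZ j))
    _ = C * ENNReal.ofReal (Real.exp (-((1 - θ) * v + 2 * θ * m) / ε + K * (d / ε))) := by
        rw [Finset.prod_mul_distrib, Finset.prod_const, ofReal_exp_pow, ← ofReal_exp_mul, hC,
          Finset.card_univ, Fintype.card_fin]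
        ring
    _ ≤ ENNReal.ofReal (Real.exp ((v - r) / 3 / ε)) *
        ENNReal.ofReal (Real.exp (-((1 - θ) * v + 2 * θ * m) / ε + K * (d / ε))) := by gcongr
    _ ≤ _ := by
        rw [ofReal_exp_mul]
        gcongr
        rw [← mul_div_assoc, ← add_div, ← add_div]
        gcongr
        linarith

lemma eventually_le_lintegral_estimator_sq (hμ : GibbsLDP γ I)
    (hI : ContinuousOn I {x | I x < ∞}) (hF : Continuous F) (hα1 : α 0 = 1)
    (hα : Antitone α) (hX : ∀ ε : ℝ, 0 < ε → ∀ j, Measurable (X ε j))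
    (hindep : ∀ ε : ℝ, 0 < ε → iIndepFun (X ε) (P ε))
    (hprob : ∀ ε : ℝ, 0 < ε → ∀ j,
      IsProbabilityMeasure (gibbsMeasure γ I (ENNReal.ofReal ε / (α j : ℝ≥0∞))))
    (hlaw : ∀ ε : ℝ, 0 < ε → ∀ j,
      HasLaw (X ε j) (gibbsMeasure γ I (ENNReal.ofReal ε / (α j : ℝ≥0∞))) (P ε))
    {r : ℝ} (hr : decayRate I F α < r) :
    ∀ᶠ ε : ℝ in 𝓝[>] 0, ENNReal.ofReal (Real.exp (-r / ε))
      ≤ ∫⁻ ω, estimator I F α ε (fun j => X ε j ω) ^ 2 ∂(P ε) := by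
  have hIm : Measurable I := hμ.ldp.measurable
  have hα' : ∀ j, α j ≤ 1 := fun j => hα1 ▸ hα (Fin.zero_le j)
  obtain ⟨J, a, ha, hJ, hobj⟩ := exists_of_decayRate_lt hα hr
  -- Half of the gap absorbs the tolerances (5K + 2)d, the other half the constant C.
  set δ := (r - objective α J (F a)) / 2 with hδ
  have hδ0 : 0 < δ := by
    rw [hδ]
    linarith
  obtain ⟨d, hd, hdδ⟩ : ∃ d : ℝ≥0, 0 < d ∧ (5 * K + 2 : ℝ) * d = δ := by
    refine ⟨⟨δ / (5 * K + 2), by positivity⟩, ?_, ?_⟩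
    · have : (0 : ℝ) < δ / (5 * K + 2) := by positivity
      exact_mod_cast this
    · change _ * (_ / _) = _
      field_simp
  -- Testing J j = J 0 first puts index 0 near a even when J 0 = 0, so the control of F on A 0 is
  -- never lost.
  set A : Fin K → Set 𝒳 := fun j => if J j = J 0
    then {y | I a ≤ I y + d ∧ I y ≤ I a + d ∧ F y ≤ F a + d} else {y | I y ≤ d} with hAdef
  have hA : ∀ j, MeasurableSet (A j) := by
    intro j
    simp only [hAdef]
    split_ifs
    · exact (measurableSet_le measurable_const (hIm.add_const _)).inter
        ((measurableSet_le hIm measurable_const).inter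
          (measurableSet_le hF.measurable measurable_const))
    · exact hIm measurableSet_Iic
  have hγA : ∀ j, γ (A j) ≠ 0 := by
    intro j
    simp only [hAdef]
    split_ifs
    · exact hμ.measure_near_ne_zero hI hF (by simp [ha]) hd
    · exact hμ.measure_sublevel_ne_zero hI hd
  have hAJ : ∀ j, ∀ y ∈ A j, I y ≠ ∞ ∧ |(I y).toReal - J j| ≤ d := by
    intro j y hy
    simp only [hAdef] at hy
    split_ifs at hy with h
    · obtain ⟨h1, h2, -⟩ := hy
      rw [ha] at h1 h2
      have hfin : I y ≠ ∞ := ne_top_of_le_ne_top (by simp) h2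
      refine ⟨hfin, ?_⟩
      lift I y to ℝ≥0 using hfin with i
      have h1' : J 0 ≤ i + d := by exact_mod_cast h1
      have h2' : i ≤ J 0 + d := by exact_mod_cast h2
      rw [← NNReal.coe_le_coe] at h1' h2'
      push_cast at h1' h2'
      rw [h, ENNReal.coe_toReal, abs_le]
      constructor <;> linarith
    · have hfin : I y ≠ ∞ := ne_top_of_le_ne_top ENNReal.coe_ne_top hy
      refine ⟨hfin, ?_⟩
      rw [(hJ j).resolve_right h, NNReal.coe_zero, sub_zero, abs_of_nonneg ENNReal.toReal_nonneg]
      exact ENNReal.toReal_le_coe_of_le_coe hy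
  have hAF : ∀ y ∈ A 0, F y ≤ F a + d := by
    intro y hy
    simp only [hAdef, if_true] at hy
    exact hy.2.2
  set σ := Tuple.sort J
  set C : ℝ≥0∞ := (Fintype.card (Equiv.Perm (Fin K)) : ℝ≥0∞)⁻¹ ^ 2 *
    ∏ j, ((partitionFunction γ I (ENNReal.ofReal 1 / α j))⁻¹ * γ (A (σ j))) with hC
  have hC0 : C ≠ 0 := by
    refine mul_ne_zero (by simp) (Finset.prod_ne_zero_iff.2 fun j _ => mul_ne_zero
      (ENNReal.inv_ne_zero.2 (partitionFunction_ne_top (hprob 1 one_pos j))) (hγA _))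
  filter_upwards [eventually_exp_neg_div_le hC0 hδ0,
    Ioc_mem_nhdsGT (zero_lt_one (α := ℝ))] with ε hCε ⟨hε, hε1⟩
  refine le_trans ?_ (le_lintegral_estimator_sq hα hα' (Tuple.monotone_sort J) hε hA hAJ hAF
    (hX ε hε) (hindep ε hε) (hlaw ε hε))
  calc ENNReal.ofReal (Real.exp (-r / ε))
      = ENNReal.ofReal (Real.exp (-δ / ε)) *
        ENNReal.ofReal (Real.exp (-(objective α J (F a) + (5 * K + 2) * d) / ε)) := by
        rw [ofReal_exp_mul, hdδ, ← add_div]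
        congr 3
        rw [hδ]
        ring
    _ ≤ C * ENNReal.ofReal (Real.exp (-(objective α J (F a) + (5 * K + 2) * d) / ε)) := by
        gcongr
    _ = (Fintype.card (Equiv.Perm (Fin K)) : ℝ≥0∞)⁻¹ ^ 2 *
        ENNReal.ofReal (Real.exp (-(objective α J (F a) + (5 * K + 2) * d) / ε)) *
        ∏ j, ((partitionFunction γ I (ENNReal.ofReal 1 / α j))⁻¹ * γ (A (σ j))) := by
        rw [hC]
        ring
    _ ≤ _ := by
        gcongr with j
        exact partitionFunction_mono (by gcongr)

end Main

end INS

theorem theorem1 {𝒳 : Type*} [TopologicalSpace 𝒳] [PolishSpace 𝒳]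
    [MeasurableSpace 𝒳] [BorelSpace 𝒳]
    (γ : Measure 𝒳) (I : 𝒳 → ℝ≥0∞) (hμ : INS.GibbsLDP γ I)
    (hI : ContinuousOn I {x | I x < ∞})
    (F : 𝒳 → ℝ) (hF : Continuous F) (hFb : BddBelow (Set.range F))
    (K : ℕ) [NeZero K] (α : Fin K → ℝ≥0) (hα1 : α 0 = 1) (hα : Antitone α)
    {Ω : ℝ → Type*} [∀ ε, MeasurableSpace (Ω ε)]
    (P : ∀ ε, Measure (Ω ε)) [∀ ε, IsProbabilityMeasure (P ε)]
    (X : ∀ ε, Fin K → Ω ε → 𝒳)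
    (hindep : ∀ ε : ℝ, 0 < ε → iIndepFun (X ε) (P ε))
    (hlaw : ∀ ε : ℝ, 0 < ε → ∀ j,
      HasLaw (X ε j) (INS.gibbsMeasure γ I (ENNReal.ofReal ε / (α j : ℝ≥0∞))) (P ε)) :
    Tendsto
      (fun ε : ℝ => -(ε : EReal) *
        ENNReal.log (∫⁻ ω, (INS.estimator I F α ε (fun j => X ε j ω)) ^ 2 ∂(P ε)))
      (𝓝[>] 0) (𝓝 (INS.decayRate I F α)) := by
  -- Read off from the laws; at α_j = 0 this encodes that γ is finite.
  have hprob : ∀ ε : ℝ, 0 < ε → ∀ j,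
      IsProbabilityMeasure (INS.gibbsMeasure γ I (ENNReal.ofReal ε / (α j : ℝ≥0∞))) :=
    fun ε hε j => (hlaw ε hε j).isProbabilityMeasure_iff.1 inferInstance
  -- `HasLaw` gives only a.e. measurability, so the samples are replaced by measurable versions,
  -- which changes neither independence, laws nor integrals.
  have hY : ∀ ε : ℝ, ∃ Y : Fin K → Ω ε → 𝒳, 0 < ε →
      (∀ j, Measurable (Y j)) ∧ ∀ j, X ε j =ᵐ[P ε] Y j := by
    intro ε
    by_cases hε : 0 < ε
    · have hX := fun j => (hlaw ε hε j).aemeasurable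
      exact ⟨fun j => (hX j).mk, fun _ => ⟨fun j => (hX j).measurable_mk, fun j => (hX j).ae_eq_mk⟩⟩
    · exact ⟨X ε, fun h => absurd h hε⟩
  choose Y hY using hY
  have hYm := fun ε hε => (hY ε hε).1
  have hindepY : ∀ ε : ℝ, 0 < ε → iIndepFun (Y ε) (P ε) := fun ε hε =>
    (hindep ε hε).congr (hY ε hε).2
  have hlawY : ∀ ε : ℝ, 0 < ε → ∀ j,
      HasLaw (Y ε j) (INS.gibbsMeasure γ I (ENNReal.ofReal ε / (α j : ℝ≥0∞))) (P ε) :=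
    fun ε hε j => (hlaw ε hε j).congr ((hY ε hε).2 j).symm
  have hcongr : (fun ε : ℝ => -(ε : EReal) *
        ENNReal.log (∫⁻ ω, (INS.estimator I F α ε (fun j => Y ε j ω)) ^ 2 ∂(P ε)))
      =ᶠ[𝓝[>] 0] fun ε : ℝ => -(ε : EReal) *
        ENNReal.log (∫⁻ ω, (INS.estimator I F α ε (fun j => X ε j ω)) ^ 2 ∂(P ε)) := by
    filter_upwards [self_mem_nhdsWithin] with ε hε
    congr 2
    refine lintegral_congr_ae ?_
    filter_upwards [ae_all_iff.2 (hY ε hε).2] with ω hω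
    simp only [hω]
  refine Tendsto.congr' hcongr ?_
  obtain ⟨m, hm⟩ := hFb
  have hbot : INS.decayRate I F α ≠ ⊥ := ne_bot_of_le_ne_bot (EReal.coe_ne_bot _)
    (INS.two_mul_le_decayRate (m := m) fun x => hm ⟨x, rfl⟩)
  obtain ⟨x, hx⟩ := hμ.exists_lt one_pos
  have htop : INS.decayRate I F α ≠ ⊤ := INS.decayRate_ne_top hx.ne_top
  have hv := EReal.coe_toReal htop hbot
  rw [← hv]
  refine INS.tendsto_neg_mul_log (fun r hr => ?_) fun r hr => ?_
  · exact INS.eventually_lintegral_estimator_sq_le hμ hI ⟨m, hm⟩ hα1 hα hYm hindepY hprob hlawY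
      hv.le hr
  · refine INS.eventually_le_lintegral_estimator_sq hμ hI hF hα1 hα hYm hindepY hprob hlawY ?_
    rw [← hv]
    exact EReal.coe_lt_coe_iff.2 hr
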